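/- Let $\mathcal H$ be a complex Hilbert space with orthonormal basis of number states $|n\rangle$, $n=0,1,2,\dots$. Let $a|n\rangle=\sqrt n\,|n-1\rangle$, $a^*|n\rangle=\sqrt{n+1}\,|n+1\rangle$, $N=a^*a$, $Q=(a^*+a)/\sqrt2$, $P=i(a^*-a)/\sqrt2$. Fix $\theta$, put $Q_\theta=e^{i\theta N}Qe^{-i\theta N}$ and $P_\theta=e^{i\theta N}Pe^{-i\theta N}$, and choose a unitary identification $\mathcal H\cong L^2(\mathbb R)$ in which $(P_\theta\varphi)(p)=p\,\varphi(p)$ and $(Q_\theta\varphi)(p)=i\,\varphi'(p)$; thus $e^{iqP_\theta}$ is multiplication by $e^{iqp}$. A POM is a map $F:\mathcal B(\mathbb R)\to\mathcal L(\mathcal H)$ such that $X\mapsto\langle\psi|F(X)\psi\rangle$ is a probability measure for every unit vector $\psi$. A fuzzy rotated quadrature is a POM $F_\theta$ with $e^{iqP_\theta}F_\theta(X)e^{-iqP_\theta}=F_\theta(X+q)$ for all $q\in\mathbb R$ and all Borel sets $X$. The fuzzy rotated quadratures (for the fixed $\theta$) form a convex set. Let $F_\theta$ be a fuzzy rotated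 quadrature associated with a measurable family of unit vectors $p\mapsto\eta_p$ of a Hilbert space $\mathcal K$, that is, $$\langle\varphi|F_\theta(X)\psi\rangle=\frac1{2\pi}\int_X\int_{\mathbb R}\int_{\mathbb R}e^{i(p-p')x}\,\langle\eta_p|\eta_{p'}\rangle\,\overline{\varphi(p)}\,\psi(p')\,dp\,dp'\,dx$$ for all Borel sets $X$ and all $\varphi,\psi\in L^1(\mathbb R)\cap L^2(\mathbb R)$, where the family spans $\mathcal K$ in the sense that the vectors $\int_{\mathbb R}\varphi(p)\,\eta_p\,dp$, $\varphi\in L^1(\mathbb R)\cap L^2(\mathbb R)$, are dense in $\mathcal K$. Then $F_\theta$ is an extreme point of the convex set of fuzzy rotated quadratures if and only if every bounded operator $A:\mathcal K\to\mathcal K$ such that $\langle\eta_p|A\eta_p\rangle=0$ for almost all $p\in\mathbb R$ is zero. -/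

import Mathlib

open MeasureTheory
open scoped ContDiff ComplexConjugate

noncomputable section

namespace RotatedQuadrature

/-! ### Ladder operators and rotated quadratures on finite combinations of number states

A finitely supported `v : ℕ →₀ ℂ` stands for the vector `∑ n, v n |n⟩`. All operators below leave
the space of these vectors invariant, and it is a core of every `Q_θ` and `P_θ`. -/

/-- The lowering operator: `a |n⟩ = √n |n - 1⟩` (so `a |0⟩ = 0`). -/
def lowering : (ℕ →₀ ℂ) →ₗ[ℂ] (ℕ →₀ ℂ) :=
  Finsupp.linearCombination ℂ fun n : ℕ => Finsupp.single (n - 1) ((Real.sqrt n : ℝ) : ℂ)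

/-- The raising operator: `a* |n⟩ = √(n+1) |n + 1⟩`. -/
def raising : (ℕ →₀ ℂ) →ₗ[ℂ] (ℕ →₀ ℂ) :=
  Finsupp.linearCombination ℂ fun n : ℕ => Finsupp.single (n + 1) ((Real.sqrt (n + 1) : ℝ) : ℂ)

/-- `Q = (a* + a) / √2`. -/
def quadQ : (ℕ →₀ ℂ) →ₗ[ℂ] (ℕ →₀ ℂ) :=
  (1 / ((Real.sqrt 2 : ℝ) : ℂ)) • (raising + lowering)

/-- `P = (a* - a) i / √2`. -/
def quadP : (ℕ →₀ ℂ) →ₗ[ℂ] (ℕ →₀ ℂ) :=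
  (Complex.I / ((Real.sqrt 2 : ℝ) : ℂ)) • (raising - lowering)

/-- `R(θ) = exp(iθN)`, with `N |n⟩ = n |n⟩`. -/
def rot (θ : ℝ) : (ℕ →₀ ℂ) →ₗ[ℂ] (ℕ →₀ ℂ) :=
  Finsupp.linearCombination ℂ fun n : ℕ =>
    Finsupp.single n (Complex.exp (Complex.I * (θ : ℂ) * (n : ℂ)))

/-- `Q_θ = R(θ) Q R(θ)*`; note `R(θ)* = R(-θ)`. -/
def rotQ (θ : ℝ) : (ℕ →₀ ℂ) →ₗ[ℂ] (ℕ →₀ ℂ) := rot θ ∘ₗ quadQ ∘ₗ rot (-θ)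

/-- `P_θ = R(θ) P R(θ)*`. -/
def rotP (θ : ℝ) : (ℕ →₀ ℂ) →ₗ[ℂ] (ℕ →₀ ℂ) := rot θ ∘ₗ quadP ∘ₗ rot (-θ)

/-! ### The rotated momentum representation -/

/-- The Hilbert space `L²(ℝ)` of complex functions, with Lebesgue measure. -/
abbrev L2 : Type := Lp ℂ 2 (volume : Measure ℝ)

variable {H : Type*} [NormedAddCommGroup H] [InnerProductSpace ℂ H]

/-- The vector `∑ n, v n |n⟩` of `H`. -/
def fockVec (ket : HilbertBasis ℕ ℂ H) (v : ℕ →₀ ℂ) : H :=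
  Finsupp.linearCombination ℂ (fun n => ket n) v

/-- `W : H ≅ L²(ℝ)` is a rotated momentum representation for the angle `θ`:
`P_θ` becomes multiplication by `p`, and `Q_θ` becomes `i d/dp` (a weak derivative).
Both are required on the finite combinations of number states, a core of both operators;
hence they hold for the self-adjoint operators `P_θ` and `Q_θ`. -/
structure IsRotatedMomentumRep (ket : HilbertBasis ℕ ℂ H) (θ : ℝ) (W : H ≃ₗᵢ[ℂ] L2) : Prop where
  momentum : ∀ v : ℕ →₀ ℂ,
    (W (fockVec ket (rotP θ v)) : ℝ → ℂ) =ᵐ[volume]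
      fun p => (p : ℂ) * (W (fockVec ket v) : ℝ → ℂ) p
  position : ∀ v : ℕ →₀ ℂ, ∀ g : ℝ → ℂ, ContDiff ℝ ∞ g → HasCompactSupport g →
    ∫ p, (W (fockVec ket (rotQ θ v)) : ℝ → ℂ) p * g p =
      -∫ p, Complex.I * (W (fockVec ket v) : ℝ → ℂ) p * deriv g p

theorem norm_phase (q p : ℝ) : ‖Complex.exp (Complex.I * (q : ℂ) * (p : ℂ))‖ = 1 := by
  have h : Complex.I * (q : ℂ) * (p : ℂ) = ((q * p : ℝ) : ℂ) * Complex.I := by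
    push_cast; ring
  rw [h, Complex.norm_exp_ofReal_mul_I]

theorem memLp_phase (q : ℝ) (f : L2) :
    MemLp (fun p : ℝ => Complex.exp (Complex.I * (q : ℂ) * (p : ℂ)) * f p) 2 volume := by
  refine (Lp.memLp f).of_le ?_ (Filter.Eventually.of_forall fun p => ?_)
  · exact (Continuous.aestronglyMeasurable (by fun_prop)).mul (Lp.aestronglyMeasurable f)
  · rw [norm_mul, norm_phase, one_mul]

/-- Multiplication by `p ↦ exp(iqp)` on `L²(ℝ)`. -/
def phaseMul (q : ℝ) : L2 →ₗᵢ[ℂ] L2 where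
  toFun f := (memLp_phase q f).toLp _
  map_add' f g := by
    apply Lp.ext
    filter_upwards [(memLp_phase q (f + g)).coeFn_toLp, (memLp_phase q f).coeFn_toLp,
      (memLp_phase q g).coeFn_toLp, Lp.coeFn_add f g,
      Lp.coeFn_add ((memLp_phase q f).toLp _) ((memLp_phase q g).toLp _)] with p h1 h2 h3 h4 h5
    rw [h1, h5, Pi.add_apply, h2, h3, h4, Pi.add_apply, mul_add]
  map_smul' c f := by
    apply Lp.ext
    filter_upwards [(memLp_phase q (c • f)).coeFn_toLp, (memLp_phase q f).coeFn_toLp,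
      Lp.coeFn_smul c f, Lp.coeFn_smul c ((memLp_phase q f).toLp _)] with p h1 h2 h3 h4
    rw [h1, RingHom.id_apply, h4, Pi.smul_apply, h2, h3, Pi.smul_apply, smul_eq_mul, smul_eq_mul]
    ring
  norm_map' f := by
    show ‖(memLp_phase q f).toLp _‖ = ‖f‖
    rw [Lp.norm_toLp, Lp.norm_def]
    congr 1
    exact eLpNorm_congr_norm_ae (Filter.Eventually.of_forall fun p => by
      rw [norm_mul, norm_phase, one_mul])

/-- `exp(iqP_θ)`: in a representation `W` where `P_θ` is multiplication by `p`, it is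
multiplication by `exp(iqp)`. -/
def expP (W : H ≃ₗᵢ[ℂ] L2) (q : ℝ) (ψ : H) : H := W.symm (phaseMul q (W ψ))

/-! ### Positive operator measures and fuzzy rotated quadratures -/

/-- The Borel subsets of the real line. -/
abbrev BorelSet : Type := {X : Set ℝ // MeasurableSet X}

/-- The translate `X + q`. -/
def BorelSet.translate (X : BorelSet) (q : ℝ) : BorelSet :=
  ⟨(fun x => x - q) ⁻¹' X.1, (measurable_id.sub_const q) X.2⟩

/-- A (normalized) positive operator measure: `X ↦ ⟨ψ, F(X) ψ⟩` is a probability measure for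
every unit vector `ψ`. -/
def IsPOM (F : BorelSet → H →L[ℂ] H) : Prop :=
  ∀ ψ : H, ‖ψ‖ = 1 → ∃ μ : Measure ℝ, IsProbabilityMeasure μ ∧
    ∀ X : BorelSet, inner ℂ ψ (F X ψ) = (((μ X.1).toReal : ℝ) : ℂ)

/-- The set of fuzzy rotated quadratures: the POMs `F` on the Borel sets of `ℝ` with
`exp(iqP_θ) F(X) exp(-iqP_θ) = F(X + q)`. -/
def fuzzyQuadratures (W : H ≃ₗᵢ[ℂ] L2) : Set (BorelSet → H →L[ℂ] H) :=
  {F | IsPOM F ∧ ∀ (q : ℝ) (X : BorelSet) (ψ : H),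
    expP W q (F X (expP W (-q) ψ)) = F (X.translate q) ψ}

variable {K : Type*} [NormedAddCommGroup K] [InnerProductSpace ℂ K]

/-- A measurable family of unit vectors `η_p` spanning `K`: the integrals `∫ φ(p) η_p dp`,
`φ ∈ L¹(ℝ) ∩ L²(ℝ)`, are dense in `K`. -/
structure IsSpanningUnitFamily (η : ℝ → K) : Prop where
  measurable : StronglyMeasurable η
  unit : ∀ p, ‖η p‖ = 1
  spanning : Dense {v : K | ∃ φ : ℝ → ℂ, Integrable φ ∧ MemLp φ 2 volume ∧ v = ∫ p, φ p • η p}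

/-- `F` is given by the family `η` in the rotated momentum representation `W`: for all integrable
`φ, ψ ∈ L²(ℝ)`,
`⟨φ, F(X) ψ⟩ = (1/2π) ∫_X ∫ ∫ exp(i(p-p')x) ⟨η_p, η_p'⟩ conj(φ(p)) ψ(p') dp dp' dx`. -/
def IsGivenBy (W : H ≃ₗᵢ[ℂ] L2) (F : BorelSet → H →L[ℂ] H) (η : ℝ → K) : Prop :=
  ∀ (X : BorelSet) (φ ψ : L2), Integrable (φ : ℝ → ℂ) → Integrable (ψ : ℝ → ℂ) →
    inner ℂ (W.symm φ) (F X (W.symm ψ)) =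
      (1 / (2 * (Real.pi : ℂ))) * ∫ x in X.1, ∫ p' : ℝ, ∫ p : ℝ,
        Complex.exp (Complex.I * ((p : ℂ) - (p' : ℂ)) * (x : ℂ)) * inner ℂ (η p) (η p') *
          conj (φ p) * ψ p'

end RotatedQuadrature

end

/-!
The formula for `F` says that `F(X) = V* χ_X V`, where `V` takes a vector to its `K`-valued wave
function `x ↦ (2π)^(-1/2) ∫ exp(-ipx) φ(p) η_p dp`. More generally a bounded operator `A` on `K`
has a compression `V* (A ⊗ χ_X) V`, which depends linearly on `A`, vanishes for all `X` only if
`A = 0` (`eq_zero_of_compression_eq_zero`), is covariant (`compression_covariant`), and has by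
Plancherel's theorem the total mass `φ ↦ ∫ |φ(p)|² ⟨η_p, A η_p⟩ dp` (`inner_compression_univ`). So
for positive `A` it is a fuzzy quadrature when `⟨η_p, A η_p⟩ = 1` almost everywhere.

If `⟨η_p, S η_p⟩ = 0` almost everywhere for a self-adjoint `S ≠ 0`, then `F` is the midpoint of the
compressions of `1 ± ε S`, which are fuzzy quadratures for small `ε`; hence `F` is not extreme. A
general `A` reduces to self-adjoint operators by taking real and imaginary parts.

Conversely let `F = a G₁ + b G₂` with `a, b > 0`. Then `a G₁ ≤ F`, and a Radon–Nikodym argument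
(`exists_eq_compression`) shows that `G₁` is the compression of some `A`: the density at `x = 0` of
`X ↦ ⟨φ, G₁(X) ψ⟩`, taken along an ultrafilter refining the averages over `[-r, r]`, `r → 0⁺`, is
bounded by `a⁻¹ ‖φ(0)‖ ‖ψ(0)‖`, where `φ(x)`, `ψ(x)` denote the unnormalized wave functions. It is
therefore a bounded sesquilinear form in `φ(0)`, `ψ(0)`, which are dense in `K`. By covariance the
same form is the density at every `x`, and Lebesgue differentiation recovers `G₁` from its density.
As `G₁` and `F` have the same total mass, `⟨η_p, (A - 1) η_p⟩ = 0` almost everywhere, so if the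
condition on the family holds then `A = 1` and `G₁ = F`.
-/

open MeasureTheory Filter Topology FourierTransform Pointwise
open scoped ContDiff ComplexConjugate

noncomputable section

namespace RotatedQuadrature

/-! ### Sesquilinear forms and the Fourier transform of vector-valued functions -/

section General

variable {E H K : Type*} [AddCommGroup E] [Module ℂ E]
  [NormedAddCommGroup H] [InnerProductSpace ℂ H]
  [NormedAddCommGroup K] [InnerProductSpace ℂ K] [CompleteSpace K]

/-- A sesquilinear form dominated by `C ‖u x‖ ‖u y‖`, where `u` has dense range, factors through
`u` and a bounded operator. -/
theorem exists_clm_of_sesq_bound (u : E →ₗ[ℂ] K) (hu : DenseRange u)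
    (Φ : E →ₗ⋆[ℂ] E →ₗ[ℂ] ℂ) {C : ℝ} (hC : 0 ≤ C) (hΦ : ∀ x y, ‖Φ x y‖ ≤ C * ‖u x‖ * ‖u y‖) :
    ∃ A : K →L[ℂ] K, ∀ x y, inner ℂ (u x) (A (u y)) = Φ x y := by
  have hfst : ∀ x y, (Φ x).extendOfNorm u (u y) = Φ x y := fun x y =>
    LinearMap.extendOfNorm_eq hu ⟨_, hΦ x⟩ y
  -- Extend in the second variable, then in the first; density of the range gives linearity.
  let g : E →ₗ⋆[ℂ] (K →L[ℂ] ℂ) :=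
    { toFun := fun x => (Φ x).extendOfNorm u
      map_add' := fun x x' => DFunLike.coe_injective <|
        hu.equalizer (map_continuous _) (map_continuous _) <| funext fun y =>
          (hfst _ y).trans (by simp [hfst])
      map_smul' := fun c x => DFunLike.coe_injective <|
        hu.equalizer (map_continuous _) (map_continuous _) <| funext fun y =>
          (hfst _ y).trans (by simp [hfst]) }
  have hg : ∀ x, ‖g x‖ ≤ C * ‖u x‖ := fun x =>
    LinearMap.opNorm_extendOfNorm_le hu (by positivity) (hΦ x)
  refine ⟨(InnerProductSpace.continuousLinearMapOfBilin (g.extendOfNorm u)).adjoint, fun x y => ?_⟩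
  rw [ContinuousLinearMap.adjoint_inner_right,
    InnerProductSpace.continuousLinearMapOfBilin_apply,
    LinearMap.extendOfNorm_eq hu ⟨C, hg⟩]
  exact hfst x y

/-- The Cauchy–Schwarz inequality for the semi-inner product of a positive operator. -/
theorem norm_inner_sq_le_of_nonneg {G : H →L[ℂ] H}
    (hG : ∀ x, ∃ r : ℝ, 0 ≤ r ∧ inner ℂ x (G x) = (r : ℂ)) (x y : H) :
    ‖inner ℂ x (G y)‖ ^ 2 ≤ (inner ℂ x (G x)).re * (inner ℂ y (G y)).re := by
  have hsymm : (G : H →ₗ[ℂ] H).IsSymmetric := by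
    rw [LinearMap.isSymmetric_iff_inner_map_self_real]
    intro v
    obtain ⟨r, -, hr⟩ := hG v
    rw [← inner_conj_symm]
    simp [hr]
  let core : PreInnerProductSpace.Core ℂ H :=
    { inner := fun v w => inner ℂ v (G w)
      conj_inner_symm := fun v w => by
        rw [inner_conj_symm]
        exact hsymm v w
      re_inner_nonneg := fun v => by
        obtain ⟨r, hr, h⟩ := hG v
        simpa [h] using hr
      add_left := fun v w z => inner_add_left _ _ _
      smul_left := fun v w c => inner_smul_left _ _ _ }
  have h := @InnerProductSpace.Core.inner_mul_inner_self_le ℂ H _ _ _ core x y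
  have h2 : ‖inner ℂ y (G x)‖ = ‖inner ℂ x (G y)‖ := by
    rw [← norm_inner_symm]
    exact congrArg _ (hsymm x y)
  calc ‖inner ℂ x (G y)‖ ^ 2 = ‖inner ℂ x (G y)‖ * ‖inner ℂ y (G x)‖ := by rw [h2, sq]
    _ ≤ _ := h

/-- On `L¹ ∩ L²` the `L²` Fourier transform is the Fourier integral: both are the Fourier
transform in the sense of tempered distributions. -/
theorem fourier_toLp_ae_eq {f : ℝ → K} (hf : Integrable f) (hf2 : MemLp f 2 volume) :
    (𝓕 (hf2.toLp f) : Lp K 2 (volume : Measure ℝ)) =ᵐ[volume] 𝓕 f := by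
  have hcont : Continuous (𝓕 f) :=
    VectorFourier.fourierIntegral_continuous Real.continuous_fourierChar
      (by exact continuous_inner) hf
  refine ae_eq_of_integral_contDiff_smul_eq
    ((Lp.memLp _).locallyIntegrable (by norm_num)) hcont.locallyIntegrable fun g hg hgc => ?_
  have hgc' : HasCompactSupport (fun x => (g x : ℂ)) := hgc.comp_left Complex.ofReal_zero
  have hg' : ContDiff ℝ ∞ (fun x => (g x : ℂ)) := Complex.ofRealCLM.contDiff.comp hg
  let s : SchwartzMap ℝ ℂ := hgc'.toSchwartzMap hg'
  have hs : ∀ x, s x = (g x : ℂ) := fun x => rfl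
  have h1 := congrArg (fun T => T s) (Lp.fourier_toTemperedDistribution_eq (hf2.toLp f))
  simp only [TemperedDistribution.fourier_apply, Lp.toTemperedDistribution_apply] at h1
  have h2 : ∫ x, s x • (𝓕 (hf2.toLp f) : Lp K 2 (volume : Measure ℝ)) x =
      ∫ x, (𝓕 s : SchwartzMap ℝ ℂ) x • f x := by
    rw [← h1]
    refine integral_congr_ae ?_
    filter_upwards [hf2.coeFn_toLp] with x hx
    rw [hx]
  have h3 : ∫ x, (𝓕 s : SchwartzMap ℝ ℂ) x • f x = ∫ x, s x • 𝓕 f x := by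
    rw [SchwartzMap.fourier_coe]
    have h4 := VectorFourier.integral_fourierIntegral_smul_eq_flip (L := innerₗ ℝ)
      Real.continuous_fourierChar (by exact continuous_inner) (s.integrable (μ := volume)) hf
    rwa [flip_innerₗ] at h4
  simpa [hs] using h2.trans h3

end General

/-! ### The subspace `L¹ ∩ L²` and the phase multiplications -/

section PhaseMul

/-- The subspace `L¹(ℝ) ∩ L²(ℝ)` of `L²(ℝ)`. -/
def integrableL2 : Submodule ℂ L2 where
  carrier := {φ : L2 | Integrable (φ : ℝ → ℂ) volume}
  add_mem' {φ ψ} hφ hψ :=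
    (Integrable.add (f := (φ : ℝ → ℂ)) (g := (ψ : ℝ → ℂ)) hφ hψ).congr (Lp.coeFn_add φ ψ).symm
  zero_mem' := (integrable_zero ℝ ℂ volume).congr (Lp.coeFn_zero ℂ 2 volume).symm
  smul_mem' c φ hφ :=
    (Integrable.smul (f := (φ : ℝ → ℂ)) c hφ).congr (Lp.coeFn_smul c φ).symm

theorem dense_integrableL2 : Dense (integrableL2 : Set L2) := by
  refine (SchwartzMap.denseRange_toLpCLM (E := ℝ) (F := ℂ) (μ := volume) (p := 2)
    ENNReal.ofNat_ne_top).mono ?_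
  rintro _ ⟨f, rfl⟩
  exact (f.integrable (μ := volume)).congr (f.coeFn_toLp 2 volume).symm

theorem coeFn_phaseMul (q : ℝ) (φ : L2) :
    (phaseMul q φ : ℝ → ℂ) =ᵐ[volume]
      fun p : ℝ => Complex.exp (Complex.I * (q : ℂ) * (p : ℂ)) * φ p :=
  (memLp_phase q φ).coeFn_toLp

theorem phaseMul_mem (q : ℝ) {φ : L2} (hφ : φ ∈ integrableL2) : phaseMul q φ ∈ integrableL2 := by
  refine Integrable.mono hφ (Lp.aestronglyMeasurable _) ?_
  filter_upwards [coeFn_phaseMul q φ] with p hp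
  rw [hp, norm_mul, norm_phase, one_mul]

theorem phaseMul_phaseMul_neg (q : ℝ) (φ : L2) : phaseMul q (phaseMul (-q) φ) = φ := by
  apply Lp.ext
  filter_upwards [coeFn_phaseMul q (phaseMul (-q) φ), coeFn_phaseMul (-q) φ] with p h1 h2
  rw [h1, h2, ← mul_assoc, ← Complex.exp_add]
  simp

theorem inner_phaseMul (q : ℝ) (φ ψ : L2) :
    inner ℂ φ (phaseMul q ψ) = inner ℂ (phaseMul (-q) φ) ψ := by
  rw [← (phaseMul q).inner_map_map (phaseMul (-q) φ) ψ, phaseMul_phaseMul_neg]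

variable {H : Type*} [NormedAddCommGroup H] [InnerProductSpace ℂ H] (W : H ≃ₗᵢ[ℂ] L2)

theorem inner_expP (q : ℝ) (φ ψ : H) : inner ℂ φ (expP W q ψ) = inner ℂ (expP W (-q) φ) ψ := by
  have h := inner_phaseMul q (W φ) (W ψ)
  unfold expP
  rw [← W.inner_map_map, W.apply_symm_apply, h, ← W.inner_map_map (W.symm _) ψ,
    W.apply_symm_apply]

variable {W} in
/-- Bounded operators on `H` are determined by their quadratic forms on `L¹ ∩ L²`. -/
theorem clm_ext_integrableL2 {G G' : H →L[ℂ] H}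
    (h : ∀ φ ∈ integrableL2, inner ℂ (W.symm φ) (G (W.symm φ)) =
      inner ℂ (W.symm φ) (G' (W.symm φ))) : G = G' := by
  have h1 : ∀ φ : L2, inner ℂ (W.symm φ) (G (W.symm φ)) = inner ℂ (W.symm φ) (G' (W.symm φ)) :=
    fun φ => dense_integrableL2.induction (P := fun φ => inner ℂ (W.symm φ) (G (W.symm φ)) =
      inner ℂ (W.symm φ) (G' (W.symm φ))) h (isClosed_eq (by fun_prop) (by fun_prop)) φ
  have h2 : (G : H →ₗ[ℂ] H) = G' := by
    refine (ext_inner_map _ _).1 fun x => ?_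
    have := congrArg conj (h1 (W x))
    simpa using this
  exact ContinuousLinearMap.coe_injective h2

end PhaseMul

/-! ### The wave functions of a spanning unit family -/

section Wave

variable {K : Type*} [NormedAddCommGroup K] [InnerProductSpace ℂ K] {η : ℝ → K}

theorem IsSpanningUnitFamily.memLp_smul (hη : IsSpanningUnitFamily η) {φ : ℝ → ℂ}
    {r : ENNReal} (hφ : MemLp φ r volume) : MemLp (fun p => φ p • η p) r volume :=
  hφ.of_le (hφ.1.smul hη.measurable.aestronglyMeasurable) <| Eventually.of_forall fun p => by
    rw [norm_smul, hη.unit, mul_one]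

theorem IsSpanningUnitFamily.integrable_smul (hη : IsSpanningUnitFamily η) {φ : ℝ → ℂ}
    (hφ : Integrable φ) : Integrable (fun p => φ p • η p) :=
  memLp_one_iff_integrable.1 (hη.memLp_smul (memLp_one_iff_integrable.2 hφ))

/-- The `K`-valued wave function `x ↦ ∫ exp(-ipx) φ(p) η_p dp`, the unnormalized Fourier transform
of `p ↦ φ(p) η_p`. -/
def wave (η : ℝ → K) (φ : ℝ → ℂ) (x : ℝ) : K :=
  ∫ p : ℝ, Complex.exp (-(Complex.I * p * x)) • φ p • η p

theorem wave_zero (φ : ℝ → ℂ) : wave η φ 0 = ∫ p, φ p • η p := by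
  simp [wave]

theorem wave_eq_fourier (φ : ℝ → ℂ) (x : ℝ) :
    wave η φ x = 𝓕 (fun p => φ p • η p) ((2 * Real.pi)⁻¹ * x) := by
  rw [wave, Real.fourier_real_eq_integral_exp_smul]
  refine integral_congr_ae (Eventually.of_forall fun p => ?_)
  have h : (((-2 * Real.pi * p * ((2 * Real.pi)⁻¹ * x) : ℝ) : ℂ)) * Complex.I =
      -(Complex.I * p * x) := by
    have : (-2 * Real.pi * p * ((2 * Real.pi)⁻¹ * x) : ℝ) = -(p * x) := by
      field_simp
    rw [this]
    push_cast
    ring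
  simp only [h]

theorem IsSpanningUnitFamily.continuous_wave [CompleteSpace K] (hη : IsSpanningUnitFamily η)
    {φ : ℝ → ℂ} (hφ : Integrable φ) : Continuous (wave η φ) := by
  have h : Continuous (𝓕 (fun p => φ p • η p)) :=
    VectorFourier.fourierIntegral_continuous Real.continuous_fourierChar
      (by exact continuous_inner) (hη.integrable_smul hφ)
  have : wave η φ = fun x => 𝓕 (fun p => φ p • η p) ((2 * Real.pi)⁻¹ * x) :=
    funext (wave_eq_fourier φ)
  rw [this]
  fun_prop

theorem norm_exp_neg_I_mul (p x : ℝ) : ‖Complex.exp (-(Complex.I * p * x))‖ = 1 := by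
  have := norm_phase (-p) x
  rwa [Complex.ofReal_neg, mul_neg, neg_mul] at this

theorem IsSpanningUnitFamily.integrable_exp_smul (hη : IsSpanningUnitFamily η)
    {φ : ℝ → ℂ} (hφ : Integrable φ) (x : ℝ) :
    Integrable fun p : ℝ => Complex.exp (-(Complex.I * p * x)) • φ p • η p := by
  refine (hη.integrable_smul hφ).mono
    ((Continuous.aestronglyMeasurable (by fun_prop)).smul (hη.integrable_smul hφ).1)
    (Eventually.of_forall fun p => ?_)
  rw [norm_smul, norm_exp_neg_I_mul, one_mul]

theorem wave_phaseMul (q : ℝ) (φ : L2) (x : ℝ) : wave η (phaseMul q φ) x = wave η φ (x - q) := by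
  refine integral_congr_ae ?_
  filter_upwards [coeFn_phaseMul q φ] with p hp
  rw [hp, mul_smul, smul_smul, ← Complex.exp_add]
  congr 2
  push_cast
  ring

/-- The inner double integral in the formula defining `F` from the family `η`. -/
theorem IsSpanningUnitFamily.integral_integral_eq_inner_wave [CompleteSpace K]
    (hη : IsSpanningUnitFamily η) {φ ψ : ℝ → ℂ} (hφ : Integrable φ) (hψ : Integrable ψ) (x : ℝ) :
    ∫ p' : ℝ, ∫ p : ℝ,
        Complex.exp (Complex.I * ((p : ℂ) - (p' : ℂ)) * (x : ℂ)) * inner ℂ (η p) (η p') *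
          conj (φ p) * ψ p' = inner ℂ (wave η φ x) (wave η ψ x) := by
  rw [wave, wave, ← integral_inner (hη.integrable_exp_smul hψ x)]
  refine integral_congr_ae (Eventually.of_forall fun p' => ?_)
  simp only
  rw [← inner_conj_symm, ← integral_inner (hη.integrable_exp_smul hφ x), ← integral_conj]
  refine integral_congr_ae (Eventually.of_forall fun p => ?_)
  simp only
  rw [inner_conj_symm]
  simp only [inner_smul_left, inner_smul_right, ← Complex.exp_conj]
  have : Complex.exp (Complex.I * ((p : ℂ) - (p' : ℂ)) * (x : ℂ)) =
      Complex.exp (conj (-(Complex.I * (p : ℂ) * x))) *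
        Complex.exp (-(Complex.I * (p' : ℂ) * x)) := by
    rw [← Complex.exp_add]
    congr 1
    simp
    ring
  rw [this]
  ring

/-- The integral `∫ φ(p) η_p dp` as a linear map on `L¹ ∩ L²`; it is the value at `0` of the wave
function of `φ`. -/
def IsSpanningUnitFamily.toSpace (hη : IsSpanningUnitFamily η) : integrableL2 →ₗ[ℂ] K where
  toFun φ := ∫ p, (φ : L2) p • η p
  map_add' φ ψ := by
    rw [← integral_add (hη.integrable_smul φ.2) (hη.integrable_smul ψ.2)]
    refine integral_congr_ae ?_
    filter_upwards [Lp.coeFn_add (φ : L2) (ψ : L2)] with p hp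
    rw [Submodule.coe_add, hp, Pi.add_apply, add_smul]
  map_smul' c φ := by
    rw [RingHom.id_apply, ← integral_smul]
    refine integral_congr_ae ?_
    filter_upwards [Lp.coeFn_smul c (φ : L2)] with p hp
    rw [Submodule.coe_smul, hp, Pi.smul_apply, smul_assoc]

theorem IsSpanningUnitFamily.toSpace_apply (hη : IsSpanningUnitFamily η) (φ : integrableL2) :
    hη.toSpace φ = wave η (φ : L2) 0 := (wave_zero _).symm

theorem IsSpanningUnitFamily.denseRange_toSpace (hη : IsSpanningUnitFamily η) :
     DenseRange hη.toSpace := by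
  refine hη.spanning.mono ?_
  rintro _ ⟨φ, hφ, hφ2, rfl⟩
  refine ⟨⟨hφ2.toLp φ, hφ.congr hφ2.coeFn_toLp.symm⟩, integral_congr_ae ?_⟩
  filter_upwards [hφ2.coeFn_toLp] with p hp
  rw [hp]

end Wave

/-! ### Compressions of operators on `K` -/

section Compression

variable {H : Type*} [NormedAddCommGroup H] [InnerProductSpace ℂ H]
  {K : Type*} [NormedAddCommGroup K] [InnerProductSpace ℂ K] {η : ℝ → K}

/-- The isometry `φ ↦ φ η` from `L²(ℝ)` to `L²(ℝ; K)`. -/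
def IsSpanningUnitFamily.mulIsometry (hη : IsSpanningUnitFamily η) :
    L2 →ₗᵢ[ℂ] Lp K 2 (volume : Measure ℝ) where
  toFun φ := (hη.memLp_smul (Lp.memLp φ)).toLp _
  map_add' φ ψ := by
    apply Lp.ext
    filter_upwards [(hη.memLp_smul (Lp.memLp (φ + ψ))).coeFn_toLp,
      (hη.memLp_smul (Lp.memLp φ)).coeFn_toLp, (hη.memLp_smul (Lp.memLp ψ)).coeFn_toLp,
      Lp.coeFn_add φ ψ, Lp.coeFn_add ((hη.memLp_smul (Lp.memLp φ)).toLp _)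
        ((hη.memLp_smul (Lp.memLp ψ)).toLp _)] with p h1 h2 h3 h4 h5
    rw [h1, h5, Pi.add_apply, h2, h3, h4, Pi.add_apply, add_smul]
  map_smul' c φ := by
    apply Lp.ext
    filter_upwards [(hη.memLp_smul (Lp.memLp (c • φ))).coeFn_toLp,
      (hη.memLp_smul (Lp.memLp φ)).coeFn_toLp, Lp.coeFn_smul c φ,
      Lp.coeFn_smul c ((hη.memLp_smul (Lp.memLp φ)).toLp _)] with p h1 h2 h3 h4
    rw [h1, RingHom.id_apply, h4, Pi.smul_apply, h2, h3, Pi.smul_apply, smul_assoc]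
  norm_map' φ := by
    change ‖(hη.memLp_smul (Lp.memLp φ)).toLp _‖ = ‖φ‖
    rw [Lp.norm_toLp, Lp.norm_def]
    congr 1
    exact eLpNorm_congr_norm_ae (Eventually.of_forall fun p => by
      rw [norm_smul, hη.unit, mul_one])

theorem IsSpanningUnitFamily.mulIsometry_apply (hη : IsSpanningUnitFamily η) (φ : L2) :
    hη.mulIsometry φ = (hη.memLp_smul (Lp.memLp φ)).toLp _ := rfl

variable [CompleteSpace K]

/-- The isometry `H → L²(ℝ; K)` taking `ψ` to the Fourier transform of `p ↦ (W ψ)(p) η_p`. It uses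
Mathlib's normalization `exp(-2πipy)` of the Fourier transform, so its values are wave functions in
the variable `y = x / 2π`. -/
def IsSpanningUnitFamily.waveIsometry (hη : IsSpanningUnitFamily η) (W : H ≃ₗᵢ[ℂ] L2) :
    H →ₗᵢ[ℂ] Lp K 2 (volume : Measure ℝ) :=
  (Lp.fourierTransformₗᵢ ℝ K).toLinearIsometry.comp (hη.mulIsometry.comp W.toLinearIsometry)

theorem IsSpanningUnitFamily.waveIsometry_apply (hη : IsSpanningUnitFamily η) (W : H ≃ₗᵢ[ℂ] L2)
    (ψ : H) : hη.waveIsometry W ψ = 𝓕 (hη.mulIsometry (W ψ)) := rfl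

theorem IsSpanningUnitFamily.waveIsometry_symm_ae_eq (hη : IsSpanningUnitFamily η)
    (W : H ≃ₗᵢ[ℂ] L2) {φ : L2} (hφ : φ ∈ integrableL2) :
    (hη.waveIsometry W (W.symm φ) : ℝ → K) =ᵐ[volume] 𝓕 (fun p => φ p • η p) := by
  rw [waveIsometry_apply, W.apply_symm_apply, mulIsometry_apply]
  exact fourier_toLp_ae_eq (hη.integrable_smul hφ) _

theorem IsSpanningUnitFamily.integrable_inner_waveIsometry (hη : IsSpanningUnitFamily η)
    (W : H ≃ₗᵢ[ℂ] L2) (A : K →L[ℂ] K) (φ ψ : H) :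
    Integrable fun y => inner ℂ ((hη.waveIsometry W φ : ℝ → K) y)
      (A ((hη.waveIsometry W ψ : ℝ → K) y)) := by
  refine (L2.integrable_inner (𝕜 := ℂ) (hη.waveIsometry W φ)
    (A.compLpL 2 volume (hη.waveIsometry W ψ))).congr ?_
  filter_upwards [ContinuousLinearMap.coeFn_compLpL A (hη.waveIsometry W ψ)] with y h
  rw [h]

theorem IsSpanningUnitFamily.integrable_inner_wave (hη : IsSpanningUnitFamily η) (A : K →L[ℂ] K)
    {φ ψ : L2} (hφ : φ ∈ integrableL2) (hψ : ψ ∈ integrableL2) :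
    Integrable fun x => inner ℂ (wave η φ x) (A (wave η ψ x)) := by
  have h : Integrable fun y =>
      inner ℂ (𝓕 (fun p => φ p • η p) y) (A (𝓕 (fun p => ψ p • η p) y)) := by
    refine (hη.integrable_inner_waveIsometry (LinearIsometryEquiv.refl ℂ L2) A φ ψ).congr ?_
    filter_upwards [hη.waveIsometry_symm_ae_eq (LinearIsometryEquiv.refl ℂ L2) hφ,
      hη.waveIsometry_symm_ae_eq (LinearIsometryEquiv.refl ℂ L2) hψ] with y h1 h2
    exact congrArg₂ (fun a b => inner ℂ a (A b)) h1 h2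
  simp only [wave_eq_fourier]
  exact h.comp_mul_left' (R := (2 * Real.pi)⁻¹) (by positivity)

/-- The Fourier transform of `L²(ℝ; K)` commutes with operators acting on the values. -/
theorem compLpL_fourier (A : K →L[ℂ] K) {f : ℝ → K} (hf : Integrable f)
    (hf2 : MemLp f 2 volume) :
    A.compLpL 2 volume (𝓕 (hf2.toLp f) : Lp K 2 (volume : Measure ℝ)) =
      𝓕 ((A.comp_memLp' hf2).toLp (fun p => A (f p))) := by
  apply Lp.ext
  filter_upwards [ContinuousLinearMap.coeFn_compLpL A
    (𝓕 (hf2.toLp f) : Lp K 2 (volume : Measure ℝ)), fourier_toLp_ae_eq hf hf2,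
    fourier_toLp_ae_eq (A.integrable_comp hf) (A.comp_memLp' hf2)] with y h1 h2 h3
  rw [h1, h2, h3]
  rw [Real.fourier_real_eq, Real.fourier_real_eq, ← A.integral_comp_comm]
  · exact integral_congr_ae (Eventually.of_forall fun p => by
      simp only [Circle.smul_def, map_smul])
  · simpa [mul_comm] using (Real.fourierIntegral_convergent_iff (V := ℝ) y).2 hf

variable [CompleteSpace H]

/-- The operator `V* (A ⊗ χ_X) V`, where `V : H → L²(ℝ; K)` takes a vector to its wave function and
`χ_X` is the indicator of `X`. In the variable `y = x / 2π` the set `X` becomes `(2π)⁻¹ X`. For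
`A = 1` this is the fuzzy quadrature associated with `η`. -/
def IsSpanningUnitFamily.compression (hη : IsSpanningUnitFamily η) (W : H ≃ₗᵢ[ℂ] L2)
    (A : K →L[ℂ] K) (X : BorelSet) : H →L[ℂ] H :=
  let Z : H →L[ℂ] Lp K 2 ((volume : Measure ℝ).restrict ((2 * Real.pi)⁻¹ • X.1)) :=
    (LpToLpRestrictCLM ℝ K ℂ volume 2 ((2 * Real.pi)⁻¹ • X.1)).comp
      (hη.waveIsometry W).toContinuousLinearMap
  Z.adjoint.comp ((A.compLpL 2 _).comp Z)

variable (hη : IsSpanningUnitFamily η) (W : H ≃ₗᵢ[ℂ] L2)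

theorem IsSpanningUnitFamily.inner_compression (A : K →L[ℂ] K) (X : BorelSet) (φ ψ : H) :
    inner ℂ φ (hη.compression W A X ψ) = ∫ y in (2 * Real.pi)⁻¹ • X.1,
      inner ℂ ((hη.waveIsometry W φ : ℝ → K) y) (A ((hη.waveIsometry W ψ : ℝ → K) y)) := by
  simp only [compression, ContinuousLinearMap.comp_apply, ContinuousLinearMap.adjoint_inner_right,
    L2.inner_def]
  refine integral_congr_ae ?_
  filter_upwards [ContinuousLinearMap.coeFn_compLpL A (LpToLpRestrictCLM ℝ K ℂ volume 2
    ((2 * Real.pi)⁻¹ • X.1) (hη.waveIsometry W ψ)),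
    LpToLpRestrictCLM_coeFn ℂ ((2 * Real.pi)⁻¹ • X.1) (hη.waveIsometry W ψ),
    LpToLpRestrictCLM_coeFn ℂ ((2 * Real.pi)⁻¹ • X.1) (hη.waveIsometry W φ)] with y h1 h2 h3
  simp only [LinearIsometry.coe_toContinuousLinearMap]
  rw [h1, h2, h3]

theorem IsSpanningUnitFamily.compression_add (A B : K →L[ℂ] K) (X : BorelSet) :
    hη.compression W (A + B) X = hη.compression W A X + hη.compression W B X := by
  refine ContinuousLinearMap.ext fun ψ => ext_inner_left ℂ fun φ => ?_
  rw [_root_.add_apply, inner_add_right, inner_compression, inner_compression,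
    inner_compression, ← integral_add (hη.integrable_inner_waveIsometry W A φ ψ).integrableOn
    (hη.integrable_inner_waveIsometry W B φ ψ).integrableOn]
  simp only [_root_.add_apply, inner_add_right]

theorem IsSpanningUnitFamily.compression_smul (c : ℂ) (A : K →L[ℂ] K) (X : BorelSet) :
    hη.compression W (c • A) X = c • hη.compression W A X := by
  refine ContinuousLinearMap.ext fun ψ => ext_inner_left ℂ fun φ => ?_
  rw [_root_.smul_apply, inner_smul_right, inner_compression, inner_compression,
    ← integral_const_mul]
  simp only [_root_.smul_apply, inner_smul_right]

theorem IsSpanningUnitFamily.inner_compression_symm (A : K →L[ℂ] K) (X : BorelSet)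
    {φ ψ : L2} (hφ : φ ∈ integrableL2) (hψ : ψ ∈ integrableL2) :
    inner ℂ (W.symm φ) (hη.compression W A X (W.symm ψ)) =
      (1 / (2 * (Real.pi : ℂ))) * ∫ x in X.1, inner ℂ (wave η φ x) (A (wave η ψ x)) := by
  have h := Measure.setIntegral_comp_smul_of_pos (volume : Measure ℝ)
    (fun y => inner ℂ (𝓕 (fun p => φ p • η p) y) (A (𝓕 (fun p => ψ p • η p) y))) X.1
    (R := (2 * Real.pi)⁻¹) (by positivity)
  have h2 : inner ℂ (W.symm φ) (hη.compression W A X (W.symm ψ)) =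
      ∫ y in (2 * Real.pi)⁻¹ • X.1,
        inner ℂ (𝓕 (fun p => φ p • η p) y) (A (𝓕 (fun p => ψ p • η p) y)) := by
    rw [inner_compression]
    refine integral_congr_ae (ae_restrict_of_ae ?_)
    filter_upwards [hη.waveIsometry_symm_ae_eq W hφ, hη.waveIsometry_symm_ae_eq W hψ] with y h1 h2
    rw [h1, h2]
  simp only [wave_eq_fourier, ← smul_eq_mul (2 * Real.pi)⁻¹]
  rw [h, h2, Module.finrank_self, pow_one, inv_inv, Complex.real_smul, ← mul_assoc]
  have : (1 / (2 * (Real.pi : ℂ))) * ((2 * Real.pi : ℝ) : ℂ) = 1 := by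
    have := Complex.ofReal_ne_zero.2 Real.pi_ne_zero
    push_cast
    field_simp
  rw [this, one_mul]

/-- Plancherel's theorem for the total mass of the compression of `A`. -/
theorem IsSpanningUnitFamily.inner_compression_univ (A : K →L[ℂ] K) {φ : L2}
    (hφ : φ ∈ integrableL2) :
    inner ℂ (W.symm φ) (hη.compression W A ⟨Set.univ, MeasurableSet.univ⟩ (W.symm φ)) =
      ∫ p, inner ℂ (φ p) (φ p) * inner ℂ (η p) (A (η p)) := by
  have hf := hη.integrable_smul hφ
  have hf2 := hη.memLp_smul (Lp.memLp φ)
  have hV : hη.waveIsometry W (W.symm φ) = 𝓕 (hf2.toLp _) := by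
    rw [waveIsometry_apply, W.apply_symm_apply, mulIsometry_apply]
  have h1 : inner ℂ (W.symm φ)
      (hη.compression W A ⟨Set.univ, MeasurableSet.univ⟩ (W.symm φ)) =
      inner ℂ (𝓕 (hf2.toLp _)) (A.compLpL 2 volume (𝓕 (hf2.toLp _))) := by
    rw [inner_compression, Set.smul_set_univ₀ (by positivity), Measure.restrict_univ, L2.inner_def,
      hV]
    refine integral_congr_ae ?_
    filter_upwards [ContinuousLinearMap.coeFn_compLpL A
      (𝓕 (hf2.toLp _) : Lp K 2 (volume : Measure ℝ))] with y h
    rw [h]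
  rw [h1, compLpL_fourier A hf hf2, Lp.inner_fourier_eq, L2.inner_def]
  refine integral_congr_ae ?_
  filter_upwards [hf2.coeFn_toLp, (A.comp_memLp' hf2).coeFn_toLp] with p h2 h3
  rw [h2]
  refine (congrArg _ h3).trans ?_
  simp only [Function.comp_apply, map_smul, inner_smul_left, inner_smul_right, RCLike.inner_apply]
  ring

theorem IsSpanningUnitFamily.compression_univ {A : K →L[ℂ] K}
    (hA : ∀ᵐ p ∂(volume : Measure ℝ), inner ℂ (η p) (A (η p)) = 1) :
    hη.compression W A ⟨Set.univ, MeasurableSet.univ⟩ = 1 := by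
  refine clm_ext_integrableL2 (W := W) fun φ hφ => ?_
  rw [hη.inner_compression_univ W A hφ, _root_.one_apply_eq_self, W.symm.inner_map_map,
    L2.inner_def]
  refine integral_congr_ae ?_
  filter_upwards [hA] with p hp
  rw [hp, mul_one]

theorem IsSpanningUnitFamily.ae_inner_eq_zero_of_compression_univ {A : K →L[ℂ] K}
    (hA : hη.compression W A ⟨Set.univ, MeasurableSet.univ⟩ = 0) :
    ∀ᵐ p ∂(volume : Measure ℝ), inner ℂ (η p) (A (η p)) = 0 := by
  have hmeas : StronglyMeasurable fun p => inner ℂ (η p) (A (η p)) :=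
    hη.measurable.inner (A.continuous.comp_stronglyMeasurable hη.measurable)
  refine ae_eq_zero_of_forall_setIntegral_eq_of_sigmaFinite (fun s hs hs' => ?_)
    fun s hs hs' => ?_
  · refine Measure.integrableOn_of_bounded (M := ‖A‖) hs'.ne hmeas.aestronglyMeasurable
      (Eventually.of_forall fun p => ?_)
    calc ‖inner ℂ (η p) (A (η p))‖ ≤ ‖η p‖ * ‖A (η p)‖ := norm_inner_le_norm _ _
      _ ≤ 1 * (‖A‖ * 1) := by
        have := A.le_opNorm (η p)
        rw [hη.unit] at this ⊢
        gcongr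
      _ = ‖A‖ := by ring
  · have hφ : indicatorConstLp 2 hs hs'.ne (1 : ℂ) ∈ integrableL2 :=
      (integrable_indicatorConstLp (p := 2) hs hs'.ne (1 : ℂ))
    -- With `φ` the indicator of `s` the total mass is the integral over `s`.
    have h := hη.inner_compression_univ W A hφ
    rw [hA, _root_.zero_apply, inner_zero_right] at h
    rw [← integral_indicator hs, h]
    refine integral_congr_ae ?_
    filter_upwards [indicatorConstLp_coeFn (p := 2) (hs := hs) (hμs := hs'.ne) (c := (1 : ℂ))]
      with p hp
    rw [hp]
    by_cases h : p ∈ s <;> simp [h]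

end Compression

/-! ### Compressions as fuzzy quadratures -/

section CompressionPOM

variable {H : Type*} [NormedAddCommGroup H] [InnerProductSpace ℂ H] [CompleteSpace H]
  {K : Type*} [NormedAddCommGroup K] [InnerProductSpace ℂ K] [CompleteSpace K] {η : ℝ → K}
  (hη : IsSpanningUnitFamily η) (W : H ≃ₗᵢ[ℂ] L2)

theorem IsSpanningUnitFamily.compression_covariant (A : K →L[ℂ] K) (q : ℝ) (X : BorelSet) (ψ : H) :
    expP W q (hη.compression W A X (expP W (-q) ψ)) = hη.compression W A (X.translate q) ψ := by
  let U : ℝ → H →L[ℂ] H := fun q =>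
    (W.symm.toLinearIsometry.comp ((phaseMul q).comp W.toLinearIsometry)).toContinuousLinearMap
  have hU : ((U q).comp ((hη.compression W A X).comp (U (-q)))) =
      hη.compression W A (X.translate q) := by
    refine clm_ext_integrableL2 (W := W) fun φ hφ => ?_
    change inner ℂ (W.symm φ) (expP W q (hη.compression W A X (expP W (-q) (W.symm φ)))) = _
    have h1 : expP W (-q) (W.symm φ) = W.symm (phaseMul (-q) φ) := by
      rw [expP, W.apply_symm_apply]
    rw [inner_expP, h1, hη.inner_compression_symm W A X (phaseMul_mem _ hφ) (phaseMul_mem _ hφ),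
      hη.inner_compression_symm W A _ hφ hφ]
    congr 1
    have h2 := (measurePreserving_add_right volume q).setIntegral_preimage_emb
      (measurableEmbedding_addRight q) (fun x => inner ℂ (wave η φ x) (A (wave η φ x)))
      (X.translate q).1
    have h3 : (fun x => x + q) ⁻¹' (X.translate q).1 = X.1 := by
      ext x
      simp [BorelSet.translate]
    rw [h3] at h2
    rw [← h2]
    simp only [wave_phaseMul, sub_neg_eq_add]
  exact congrArg (fun T => T ψ) hU

theorem IsSpanningUnitFamily.compression_isPOM {A : K →L[ℂ] K}
    (hpos : ∀ v, ∃ r : ℝ, 0 ≤ r ∧ inner ℂ v (A v) = (r : ℂ))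
    (hA : ∀ᵐ p ∂(volume : Measure ℝ), inner ℂ (η p) (A (η p)) = 1) :
    IsPOM (hη.compression W A) := by
  intro ψ hψ
  set g : ℝ → ℂ := fun y => inner ℂ ((hη.waveIsometry W ψ : ℝ → K) y)
    (A ((hη.waveIsometry W ψ : ℝ → K) y)) with hg
  have hgint : Integrable g := hη.integrable_inner_waveIsometry W A ψ ψ
  have hg0 : ∀ y, 0 ≤ (g y).re := fun y => by
    obtain ⟨r, hr, h⟩ := hpos ((hη.waveIsometry W ψ : ℝ → K) y)
    simpa [hg, h] using hr
  have hgre : ∀ y, ((g y).re : ℂ) = g y := fun y => by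
    obtain ⟨r, hr, h⟩ := hpos ((hη.waveIsometry W ψ : ℝ → K) y)
    simp [hg, h]
  have hgint' : Integrable fun y => (g y).re := hgint.re
  have hscale : ∀ X : Set ℝ, (fun y : ℝ => (2 * Real.pi) * y) ⁻¹' X = (2 * Real.pi)⁻¹ • X :=
    fun X => Set.preimage_smul₀ (a := 2 * Real.pi) (by positivity) X
  let μ : Measure ℝ :=
    (volume.withDensity fun y => ENNReal.ofReal (g y).re).map fun y : ℝ => (2 * Real.pi) * y
  have hμ : ∀ X : BorelSet, μ X.1 =
      ENNReal.ofReal (inner ℂ ψ (hη.compression W A X ψ)).re ∧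
      ((inner ℂ ψ (hη.compression W A X ψ)).re : ℂ) = inner ℂ ψ (hη.compression W A X ψ) ∧
      0 ≤ (inner ℂ ψ (hη.compression W A X ψ)).re := by
    intro X
    have hX : MeasurableSet ((2 * Real.pi)⁻¹ • X.1) := by
      rw [← hscale]
      exact (measurable_const_mul _) X.2
    have h1 : inner ℂ ψ (hη.compression W A X ψ) =
        ((∫ y in (2 * Real.pi)⁻¹ • X.1, (g y).re : ℝ) : ℂ) := by
      rw [hη.inner_compression W A X, ← integral_complex_ofReal]
      exact integral_congr_ae (Eventually.of_forall fun y => (hgre y).symm)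
    rw [h1, Complex.ofReal_re]
    refine ⟨?_, rfl, integral_nonneg hg0⟩
    rw [Measure.map_apply (measurable_const_mul _) X.2, hscale, withDensity_apply _ hX,
      ofReal_integral_eq_lintegral_ofReal hgint'.integrableOn (Eventually.of_forall hg0)]
  refine ⟨μ, ⟨?_⟩, fun X => ?_⟩
  · have h := (hμ ⟨Set.univ, MeasurableSet.univ⟩).1
    rw [hη.compression_univ W hA, _root_.one_apply_eq_self,
      inner_self_eq_norm_sq_to_K, hψ] at h
    simpa using h
  · obtain ⟨h1, h2, h3⟩ := hμ X
    rw [h1, ENNReal.toReal_ofReal h3, h2]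

theorem IsSpanningUnitFamily.compression_mem_fuzzyQuadratures {A : K →L[ℂ] K}
    (hpos : ∀ v, ∃ r : ℝ, 0 ≤ r ∧ inner ℂ v (A v) = (r : ℂ))
    (hA : ∀ᵐ p ∂(volume : Measure ℝ), inner ℂ (η p) (A (η p)) = 1) :
    hη.compression W A ∈ fuzzyQuadratures W :=
  ⟨hη.compression_isPOM W hpos hA, hη.compression_covariant W A⟩

theorem IsGivenBy.eq_compression_one {F : BorelSet → H →L[ℂ] H} (hF : IsGivenBy W F η) :
    F = hη.compression W 1 := by
  funext X
  refine clm_ext_integrableL2 (W := W) fun φ hφ => ?_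
  rw [hF X φ φ hφ hφ, hη.inner_compression_symm W 1 X hφ hφ]
  simp only [hη.integral_integral_eq_inner_wave hφ hφ, _root_.one_apply_eq_self]

/-- The continuous function `x ↦ ⟨φ(x), A ψ(x)⟩` of two wave functions vanishes almost everywhere,
hence at `0`; the values at `0` of the wave functions are dense in `K`. -/
theorem IsSpanningUnitFamily.eq_zero_of_compression_eq_zero {A : K →L[ℂ] K}
    (hA : ∀ X, hη.compression W A X = 0) : A = 0 := by
  have key : ∀ φ ψ : integrableL2, inner ℂ (hη.toSpace φ) (A (hη.toSpace ψ)) = 0 := by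
    intro φ ψ
    have hcont : Continuous fun x => inner ℂ (wave η (φ : L2) x) (A (wave η (ψ : L2) x)) :=
      (hη.continuous_wave φ.2).inner (A.continuous.comp (hη.continuous_wave ψ.2))
    have hae : (fun x => inner ℂ (wave η (φ : L2) x) (A (wave η (ψ : L2) x))) =ᵐ[volume]
        fun _ => (0 : ℂ) := by
      refine (hη.integrable_inner_wave A φ.2 ψ.2).ae_eq_of_forall_setIntegral_eq _ _
        (integrable_zero _ _ _) fun s hs _ => ?_
      have h := hη.inner_compression_symm W A ⟨s, hs⟩ φ.2 ψ.2
      rw [hA, _root_.zero_apply, inner_zero_right] at h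
      have hne : (1 / (2 * (Real.pi : ℂ))) ≠ 0 := by
        have := Complex.ofReal_ne_zero.2 Real.pi_ne_zero
        simp [this]
      simpa using (mul_eq_zero.1 h.symm).resolve_left hne
    rw [toSpace_apply, toSpace_apply]
    exact congrFun (hcont.ae_eq_iff_eq volume continuous_const |>.1 hae) 0
  have key2 : ∀ v, ∀ ψ, inner ℂ v (A (hη.toSpace ψ)) = 0 := fun v ψ =>
    hη.denseRange_toSpace.induction_on (p := fun v => inner ℂ v (A (hη.toSpace ψ)) = 0) v
      (isClosed_eq (by fun_prop) continuous_const) fun φ => key φ ψ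
  have key3 : ∀ ψ, A (hη.toSpace ψ) = 0 := fun ψ => inner_self_eq_zero.1 (key2 _ ψ)
  exact ContinuousLinearMap.ext fun v =>
    hη.denseRange_toSpace.induction_on (p := fun v => A v = 0) v
      (isClosed_eq (by fun_prop) continuous_const) key3

/-! ### Perturbations of an extreme point -/

/-- A self-adjoint `S` with `⟨η_p, S η_p⟩ = 0` gives the two quadratures belonging to
`1 ± ε S`, whose midpoint is the quadrature of `η`. -/
theorem IsSpanningUnitFamily.eq_zero_of_isSelfAdjoint
    (hext : hη.compression W 1 ∈ Set.extremePoints ℝ (fuzzyQuadratures W))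
    {S : K →L[ℂ] K} (hS : IsSelfAdjoint S)
    (h0 : ∀ᵐ p ∂(volume : Measure ℝ), inner ℂ (η p) (S (η p)) = 0) : S = 0 := by
  -- Small enough that `‖ε S‖ ≤ 1`, so that `1 ± ε S` is positive.
  set ε : ℝ := (‖S‖ + 1)⁻¹ with hε
  have hεpos : 0 < ε := by positivity
  have hmem : ∀ c : ℝ, |c| = ε → hη.compression W (1 + (c : ℂ) • S) ∈ fuzzyQuadratures W := by
    intro c hc
    refine hη.compression_mem_fuzzyQuadratures W (fun v => ?_) ?_
    · have hre : ((inner ℂ v (S v)).re : ℂ) = inner ℂ v (S v) := by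
        rw [← Complex.conj_eq_iff_re, inner_conj_symm]
        exact hS.isSymmetric v v
      refine ⟨‖v‖ ^ 2 + c * (inner ℂ v (S v)).re, ?_, ?_⟩
      · have h1 : |c * (inner ℂ v (S v)).re| ≤ ‖v‖ ^ 2 := by
          rw [abs_mul, hc]
          calc ε * |(inner ℂ v (S v)).re| ≤ ε * (‖v‖ * (‖S‖ * ‖v‖)) := by
                gcongr
                exact (Complex.abs_re_le_norm _).trans
                  ((norm_inner_le_norm _ _).trans (by gcongr; exact S.le_opNorm v))
            _ = (ε * ‖S‖) * ‖v‖ ^ 2 := by ring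
            _ ≤ 1 * ‖v‖ ^ 2 := by
                gcongr
                rw [hε, inv_mul_le_iff₀ (by positivity)]
                linarith
            _ = ‖v‖ ^ 2 := one_mul _
        linarith [neg_abs_le (c * (inner ℂ v (S v)).re)]
      · simp only [_root_.add_apply, _root_.smul_apply, _root_.one_apply_eq_self, inner_add_right,
          inner_smul_right, inner_self_eq_norm_sq_to_K]
        push_cast
        rw [hre]
        rfl
    · filter_upwards [h0] with p hp
      simp [hp, hη.unit]
  have h1 := hext.2 (hmem ε (abs_of_pos hεpos)) (hmem (-ε) (by rw [abs_neg, abs_of_pos hεpos]))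
    ⟨1 / 2, 1 / 2, by norm_num, by norm_num, by norm_num, by
      funext X
      refine ContinuousLinearMap.ext fun ψ => ?_
      simp only [Pi.add_apply, Pi.smul_apply, hη.compression_add, hη.compression_smul,
        _root_.add_apply, _root_.smul_apply, Complex.ofReal_neg]
      module⟩
  have h2 : ((ε : ℂ) • S) = 0 := by
    refine hη.eq_zero_of_compression_eq_zero W fun X => ?_
    have := congrFun h1 X
    rwa [hη.compression_add, add_eq_left] at this
  exact (smul_eq_zero.1 h2).resolve_left (Complex.ofReal_ne_zero.2 hεpos.ne')

/-- The general case follows from the self-adjoint one for `A + A*` and `i (A - A*)`. -/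
theorem IsSpanningUnitFamily.eq_zero_of_extreme
    (hext : hη.compression W 1 ∈ Set.extremePoints ℝ (fuzzyQuadratures W))
    {A : K →L[ℂ] K} (h0 : ∀ᵐ p ∂(volume : Measure ℝ), inner ℂ (η p) (A (η p)) = 0) : A = 0 := by
  have h0' : ∀ᵐ p ∂(volume : Measure ℝ), inner ℂ (η p) (A.adjoint (η p)) = 0 := by
    filter_upwards [h0] with p hp
    rw [ContinuousLinearMap.adjoint_inner_right, ← inner_conj_symm, hp, map_zero]
  have h1 : A + A.adjoint = 0 := by
    refine hη.eq_zero_of_isSelfAdjoint W hext ?_ ?_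
    · exact IsSelfAdjoint.add_star_self A
    · filter_upwards [h0, h0'] with p hp hp'
      rw [_root_.add_apply, inner_add_right, hp, hp', add_zero]
  have h2 : Complex.I • (A - A.adjoint) = 0 := by
    refine hη.eq_zero_of_isSelfAdjoint W hext ?_ ?_
    · rw [IsSelfAdjoint, star_smul, star_sub, ← ContinuousLinearMap.star_eq_adjoint, star_star]
      simp only [Complex.star_def, Complex.conj_I]
      module
    · filter_upwards [h0, h0'] with p hp hp'
      rw [_root_.smul_apply, _root_.sub_apply, inner_smul_right, inner_sub_right, hp, hp',
        sub_zero, mul_zero]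
  have h3 := (smul_eq_zero.1 h2).resolve_left Complex.I_ne_zero
  have h4 : (2 : ℂ) • A = (A + A.adjoint) + (A - A.adjoint) := by module
  rw [h1, h3, add_zero] at h4
  exact (smul_eq_zero.1 h4).resolve_left two_ne_zero

end CompressionPOM

/-! ### Quadratures dominated by that of a spanning unit family -/

section Dominated

variable {H : Type*} [NormedAddCommGroup H] [InnerProductSpace ℂ H]

theorem IsPOM.exists_measure {G : BorelSet → H →L[ℂ] H} (hG : IsPOM G) (ψ : H) :
    ∃ μ : Measure ℝ, IsFiniteMeasure μ ∧ μ Set.univ = ENNReal.ofReal (‖ψ‖ ^ 2) ∧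
      ∀ X : BorelSet, inner ℂ ψ (G X ψ) = (((μ X.1).toReal : ℝ) : ℂ) := by
  rcases eq_or_ne ψ 0 with rfl | hψ
  · exact ⟨0, inferInstance, by simp, fun X => by simp⟩
  · have hn : ‖ψ‖ ≠ 0 := norm_ne_zero_iff.2 hψ
    obtain ⟨μ, hμ, h⟩ := hG (((‖ψ‖⁻¹ : ℝ) : ℂ) • ψ) (by simp [norm_smul, hn])
    refine ⟨ENNReal.ofReal (‖ψ‖ ^ 2) • μ, ⟨by simp⟩, by simp, fun X => ?_⟩
    have hX := h X
    rw [map_smul, inner_smul_left, inner_smul_right, Complex.conj_ofReal] at hX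
    rw [Measure.smul_apply, smul_eq_mul, ENNReal.toReal_mul, ENNReal.toReal_ofReal (by positivity)]
    push_cast
    rw [← hX]
    have : (‖ψ‖ : ℂ) ≠ 0 := Complex.ofReal_ne_zero.2 hn
    push_cast
    field_simp

theorem IsPOM.exists_nonneg {G : BorelSet → H →L[ℂ] H} (hG : IsPOM G) (X : BorelSet) (ψ : H) :
    ∃ r : ℝ, 0 ≤ r ∧ inner ℂ ψ (G X ψ) = (r : ℂ) := by
  obtain ⟨μ, -, -, h⟩ := hG.exists_measure ψ
  exact ⟨_, ENNReal.toReal_nonneg, h X⟩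

theorem IsPOM.univ {G : BorelSet → H →L[ℂ] H} (hG : IsPOM G) :
    G ⟨Set.univ, MeasurableSet.univ⟩ = 1 := by
  refine ContinuousLinearMap.coe_injective ((ext_inner_map _ _).1 fun ψ => ?_)
  obtain ⟨μ, -, hμ, h⟩ := hG.exists_measure ψ
  have h1 := h ⟨Set.univ, MeasurableSet.univ⟩
  rw [hμ, ENNReal.toReal_ofReal (by positivity)] at h1
  have h2 := congrArg conj h1
  rw [inner_conj_symm, Complex.conj_ofReal] at h2
  refine h2.trans ?_
  rw [ContinuousLinearMap.coe_coe, _root_.one_apply_eq_self, inner_self_eq_norm_sq_to_K]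
  push_cast
  rfl

/-- The interval `[-r, r]`. -/
def symmInterval (r : ℝ) : BorelSet :=
  ⟨Metric.closedBall 0 r, Metric.isClosed_closedBall.measurableSet⟩

theorem symmInterval_translate (r x : ℝ) :
    ((symmInterval r).translate x).1 = Metric.closedBall x r := by
  ext y
  simp [symmInterval, BorelSet.translate, Metric.mem_closedBall, Real.dist_eq]

variable (W : H ≃ₗᵢ[ℂ] L2)

/-- The averaged density `⟨φ, G([-r, r]) ψ⟩ / 2r` over `[-r, r]`, times `2π`. The factor `2π` makes
it comparable with the unnormalized wave functions: for the quadrature of `η` its limit as `r → 0⁺`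
is the inner product of their values at `0`. -/
def avgDensity (G : BorelSet → H →L[ℂ] H) (r : ℝ) (φ ψ : L2) : ℂ :=
  ((Real.pi / r : ℝ) : ℂ) * inner ℂ (W.symm φ) (G (symmInterval r) (W.symm ψ))

theorem norm_avgDensity_sq_le {G F : BorelSet → H →L[ℂ] H} (hG : IsPOM G) {c : ℝ} (hc : 0 < c)
    (hdom : ∀ X ψ, c * (inner ℂ ψ (G X ψ)).re ≤ (inner ℂ ψ (F X ψ)).re) {r : ℝ} (hr : 0 < r)
    (φ ψ : L2) : ‖avgDensity W G r φ ψ‖ ^ 2 ≤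
      c⁻¹ ^ 2 * ((avgDensity W F r φ φ).re * (avgDensity W F r ψ ψ).re) := by
  have h1 := norm_inner_sq_le_of_nonneg (hG.exists_nonneg (symmInterval r)) (W.symm φ) (W.symm ψ)
  have h0 : ∀ v : H, 0 ≤ (inner ℂ v (G (symmInterval r) v)).re := fun v => by
    obtain ⟨s, hs, h⟩ := hG.exists_nonneg (symmInterval r) v
    rwa [h, Complex.ofReal_re]
  have h2 : ∀ v : H, (inner ℂ v (G (symmInterval r) v)).re ≤
      c⁻¹ * (inner ℂ v (F (symmInterval r) v)).re := fun v => by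
    rw [le_inv_mul_iff₀ hc]
    exact hdom _ v
  rw [avgDensity, avgDensity, avgDensity, norm_mul, Complex.norm_real, Complex.re_ofReal_mul,
    Complex.re_ofReal_mul, Real.norm_of_nonneg (by positivity), mul_pow]
  calc (Real.pi / r) ^ 2 * _ ≤ (Real.pi / r) ^ 2 *
        ((c⁻¹ * (inner ℂ (W.symm φ) (F (symmInterval r) (W.symm φ))).re) *
          (c⁻¹ * (inner ℂ (W.symm ψ) (F (symmInterval r) (W.symm ψ))).re)) := by
        gcongr
        exact h1.trans (mul_le_mul (h2 _) (h2 _) (h0 _) ((h0 _).trans (h2 _)))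
    _ = _ := by ring

variable [CompleteSpace H]
  {K : Type*} [NormedAddCommGroup K] [InnerProductSpace ℂ K] [CompleteSpace K] {η : ℝ → K}
  (hη : IsSpanningUnitFamily η)

theorem IsSpanningUnitFamily.eventually_avgDensity_le {φ : L2} (hφ : φ ∈ integrableL2) {δ : ℝ}
    (hδ : 0 < δ) : ∀ᶠ r in 𝓝[>] (0 : ℝ),
      (avgDensity W (hη.compression W 1) r φ φ).re ≤ ‖wave η φ 0‖ ^ 2 + δ := by
  have hcont : Continuous fun x => ‖wave η φ x‖ ^ 2 := (hη.continuous_wave hφ).norm.pow 2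
  have h1 : ∀ᶠ x in 𝓝 (0 : ℝ), ‖wave η φ x‖ ^ 2 < ‖wave η φ 0‖ ^ 2 + δ :=
    hcont.continuousAt.eventually (gt_mem_nhds (by linarith))
  obtain ⟨ε, hε, h2⟩ := Metric.eventually_nhds_iff_ball.1 h1
  filter_upwards [Ioo_mem_nhdsGT hε] with r hr
  have hr0 : 0 < r := hr.1
  have h3 : ‖∫ x in (symmInterval r).1, inner ℂ (wave η φ x) ((1 : K →L[ℂ] K) (wave η φ x))‖ ≤
      (‖wave η φ 0‖ ^ 2 + δ) * volume.real (symmInterval r).1 := by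
    refine norm_setIntegral_le_of_norm_le_const ?_ fun x hx => ?_
    · exact Metric.isBounded_closedBall.measure_lt_top
    · rw [_root_.one_apply_eq_self, inner_self_eq_norm_sq_to_K]
      have h := (h2 x (Metric.closedBall_subset_ball hr.2 hx)).le
      simpa using h
  have h4 : volume.real (symmInterval r).1 = 2 * r := by
    simp [symmInterval, Measure.real, Real.volume_closedBall, hr0.le]
  rw [h4] at h3
  refine (Complex.re_le_norm _).trans ?_
  have h5 : ‖(1 / (2 * (Real.pi : ℂ)))‖ = 1 / (2 * Real.pi) := by
    simp [abs_of_pos Real.pi_pos]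
  rw [avgDensity, hη.inner_compression_symm W 1 _ hφ hφ, norm_mul, norm_mul, h5,
    Complex.norm_real, Real.norm_of_nonneg (by positivity)]
  calc Real.pi / r * (1 / (2 * Real.pi) * _)
      ≤ Real.pi / r * (1 / (2 * Real.pi) * ((‖wave η φ 0‖ ^ 2 + δ) * (2 * r))) := by gcongr
    _ = ‖wave η φ 0‖ ^ 2 + δ := by
      have := Real.pi_ne_zero
      field_simp

/-- The density at `0` of a dominated quadrature, taken along an ultrafilter refining `r → 0⁺`, is
a bounded sesquilinear form in the values at `0` of the wave functions. -/
theorem IsSpanningUnitFamily.exists_tendsto_avgDensity {G : BorelSet → H →L[ℂ] H} (hG : IsPOM G)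
    {c : ℝ} (hc : 0 < c) (hdom : ∀ X ψ, c * (inner ℂ ψ (G X ψ)).re ≤
      (inner ℂ ψ (hη.compression W 1 X ψ)).re)
    (U : Ultrafilter ℝ) (hU : (U : Filter ℝ) ≤ 𝓝[>] 0) :
    ∃ A : K →L[ℂ] K, ∀ φ ψ : integrableL2,
      Tendsto (fun r => avgDensity W G r φ ψ) U
        (𝓝 (inner ℂ (hη.toSpace φ) (A (hη.toSpace ψ)))) := by
  have hbound : ∀ φ ψ : integrableL2, ∀ δ > 0, ∀ᶠ r in (U : Filter ℝ),
      ‖avgDensity W G r φ ψ‖ ^ 2 ≤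
        c⁻¹ ^ 2 * ((‖hη.toSpace φ‖ ^ 2 + δ) * (‖hη.toSpace ψ‖ ^ 2 + δ)) := by
    intro φ ψ δ hδ
    apply hU
    filter_upwards [hη.eventually_avgDensity_le W φ.2 hδ, hη.eventually_avgDensity_le W ψ.2 hδ,
      self_mem_nhdsWithin] with r h1 h2 hr
    refine (norm_avgDensity_sq_le W hG hc hdom hr _ _).trans ?_
    rw [← hη.toSpace_apply] at h1 h2
    have h0 : ∀ χ : L2, 0 ≤ (avgDensity W (hη.compression W 1) r χ χ).re := fun χ => by
      obtain ⟨s, hs, h⟩ := hG.exists_nonneg (symmInterval r) (W.symm χ)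
      have h3 := hdom (symmInterval r) (W.symm χ)
      rw [h, Complex.ofReal_re] at h3
      rw [avgDensity, Complex.re_ofReal_mul]
      have hr' : 0 < r := hr
      exact mul_nonneg (by positivity) ((by positivity : 0 ≤ c * s).trans h3)
    exact mul_le_mul_of_nonneg_left
      (mul_le_mul h1 h2 (h0 _) ((h0 _).trans h1)) (by positivity)
  have hlim : ∀ φ ψ : integrableL2, ∃ L : ℂ,
      Tendsto (fun r => avgDensity W G r φ ψ) U (𝓝 L) := by
    intro φ ψ
    set R := c⁻¹ ^ 2 * ((‖hη.toSpace φ‖ ^ 2 + 1) * (‖hη.toSpace ψ‖ ^ 2 + 1))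
    obtain ⟨L, -, hL⟩ := (isCompact_closedBall (0 : ℂ) (R + 1)).ultrafilter_le_nhds'
      (U.map fun r => avgDensity W G r φ ψ) (by
        refine Ultrafilter.mem_map.2 (Filter.mem_of_superset (hbound φ ψ 1 one_pos) fun r hr => ?_)
        rw [Set.mem_ofPred_eq] at hr
        rw [Set.mem_preimage, mem_closedBall_zero_iff]
        -- `t² ≤ R` gives `t ≤ (1 + R) / 2 ≤ R + 1`.
        nlinarith [sq_nonneg (‖avgDensity W G r φ ψ‖ - 1)])
    exact ⟨L, hL⟩
  choose L hL using hlim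
  have huniq : ∀ {φ ψ : integrableL2} {z : ℂ},
      Tendsto (fun r => avgDensity W G r φ ψ) U (𝓝 z) → L φ ψ = z :=
    fun h => tendsto_nhds_unique (hL _ _) h
  let Φ : integrableL2 →ₗ⋆[ℂ] integrableL2 →ₗ[ℂ] ℂ :=
    LinearMap.mk₂'ₛₗ (starRingEnd ℂ) (RingHom.id ℂ) L
      (fun φ φ' ψ => huniq (((hL φ ψ).add (hL φ' ψ)).congr fun r => by
        simp only [avgDensity, Submodule.coe_add, map_add, inner_add_left]; ring))
      (fun a φ ψ => huniq (((hL φ ψ).const_mul (conj a)).congr fun r => by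
        simp only [avgDensity, Submodule.coe_smul, map_smul, inner_smul_left]; ring))
      (fun φ ψ ψ' => huniq (((hL φ ψ).add (hL φ ψ')).congr fun r => by
        simp only [avgDensity, Submodule.coe_add, map_add, inner_add_right]; ring))
      (fun a φ ψ => huniq (((hL φ ψ).const_mul a).congr fun r => by
        simp only [avgDensity, Submodule.coe_smul, map_smul, inner_smul_right]; ring))
  have hΦ : ∀ φ ψ, ‖Φ φ ψ‖ ≤ c⁻¹ * ‖hη.toSpace φ‖ * ‖hη.toSpace ψ‖ := by
    intro φ ψ
    have h1 : ∀ δ > 0, ‖L φ ψ‖ ^ 2 ≤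
        c⁻¹ ^ 2 * ((‖hη.toSpace φ‖ ^ 2 + δ) * (‖hη.toSpace ψ‖ ^ 2 + δ)) := fun δ hδ =>
      le_of_tendsto ((hL φ ψ).norm.pow 2) (hbound φ ψ δ hδ)
    have h2 : Tendsto (fun δ : ℝ =>
        c⁻¹ ^ 2 * ((‖hη.toSpace φ‖ ^ 2 + δ) * (‖hη.toSpace ψ‖ ^ 2 + δ))) (𝓝[>] 0)
        (𝓝 (c⁻¹ ^ 2 * ((‖hη.toSpace φ‖ ^ 2 + 0) * (‖hη.toSpace ψ‖ ^ 2 + 0)))) :=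
      (Continuous.tendsto (by fun_prop) 0).mono_left nhdsWithin_le_nhds
    have h3 : ‖L φ ψ‖ ^ 2 ≤ (c⁻¹ * ‖hη.toSpace φ‖ * ‖hη.toSpace ψ‖) ^ 2 := by
      refine (ge_of_tendsto h2 (eventually_mem_nhdsWithin.mono h1)).trans_eq ?_
      ring
    exact le_of_sq_le_sq h3 (by positivity)
  obtain ⟨A, hA⟩ := exists_clm_of_sesq_bound hη.toSpace hη.denseRange_toSpace Φ
    (inv_nonneg.2 hc.le) hΦ
  exact ⟨A, fun φ ψ => by rw [hA]; exact hL φ ψ⟩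

/-- A Radon–Nikodym theorem for quadratures: a covariant positive operator measure dominated by a
multiple of the quadrature of `η` is the compression of a bounded operator on `K`. The operator is
obtained from the density at `0`; covariance gives the density at every other point, and by
Lebesgue differentiation the measure is the integral of its density. -/
theorem IsSpanningUnitFamily.exists_eq_compression {G : BorelSet → H →L[ℂ] H}
    (hG : G ∈ fuzzyQuadratures W) {c : ℝ} (hc : 0 < c)
    (hdom : ∀ X ψ, c * (inner ℂ ψ (G X ψ)).re ≤ (inner ℂ ψ (hη.compression W 1 X ψ)).re) :
    ∃ A : K →L[ℂ] K, G = hη.compression W A := by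
  set U : Ultrafilter ℝ := Ultrafilter.of (𝓝[>] (0 : ℝ))
  have hU : (U : Filter ℝ) ≤ 𝓝[>] 0 := Ultrafilter.of_le _
  obtain ⟨A, hA⟩ := hη.exists_tendsto_avgDensity W hG.1 hc hdom U hU
  refine ⟨A, funext fun X => clm_ext_integrableL2 (W := W) fun φ hφ => ?_⟩
  obtain ⟨μ, hμfin, -, hμ⟩ := hG.1.exists_measure (W.symm φ)
  have hac : μ ≪ volume := by
    refine Measure.AbsolutelyContinuous.mk fun s hs hs0 => ?_
    have h1 := hdom ⟨s, hs⟩ (W.symm φ)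
    rw [hμ, hη.inner_compression_symm W 1 ⟨s, hs⟩ hφ hφ, Measure.restrict_eq_zero.2 hs0,
      integral_zero_measure, mul_zero, Complex.ofReal_re, Complex.zero_re] at h1
    have h2 : (μ s).toReal = 0 :=
      le_antisymm (nonpos_of_mul_nonpos_right h1 hc) ENNReal.toReal_nonneg
    exact ((ENNReal.toReal_eq_zero_iff _).1 h2).resolve_right (measure_ne_top μ s)
  have hdens : ∀ᵐ x ∂(volume : Measure ℝ), inner ℂ (wave η φ x) (A (wave η φ x)) =
      (2 * (Real.pi : ℂ)) * (((μ.rnDeriv volume x).toReal : ℝ) : ℂ) := by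
    filter_upwards [Besicovitch.ae_tendsto_rnDeriv μ volume, μ.rnDeriv_lt_top volume] with x hx hx'
    let φx : integrableL2 := ⟨phaseMul (-x) φ, phaseMul_mem _ hφ⟩
    -- The density at `x` for `φ` is the density at `0` for the translate `exp(-ixP) φ`.
    have h1 := hA φx φx
    have h2 : hη.toSpace φx = wave η φ x := by
      rw [hη.toSpace_apply, wave_phaseMul, sub_neg_eq_add, zero_add]
    rw [h2] at h1
    have h3 : Tendsto (fun r => (2 * (Real.pi : ℂ)) *
        (((μ (Metric.closedBall x r) / volume (Metric.closedBall x r)).toReal : ℝ) : ℂ)) U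
        (𝓝 ((2 * (Real.pi : ℂ)) * (((μ.rnDeriv volume x).toReal : ℝ) : ℂ))) :=
      (((Complex.continuous_ofReal.tendsto _).comp
        ((ENNReal.tendsto_toReal hx'.ne).comp (hx.mono_left hU))).const_mul _)
    refine tendsto_nhds_unique h1 (h3.congr' (hU ?_))
    filter_upwards [self_mem_nhdsWithin] with r hr
    have hr' : 0 < r := hr
    have h4 : inner ℂ (W.symm φx) (G (symmInterval r) (W.symm φx)) =
        (((μ (Metric.closedBall x r)).toReal : ℝ) : ℂ) := by
      have h5 : W.symm φx = expP W (-x) (W.symm φ) := by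
        rw [expP, W.apply_symm_apply]
      rw [h5, ← inner_expP, hG.2, hμ, symmInterval_translate]
    rw [avgDensity, h4, Real.volume_closedBall, ENNReal.toReal_div,
      ENNReal.toReal_ofReal (by positivity)]
    have : (r : ℂ) ≠ 0 := Complex.ofReal_ne_zero.2 hr'.ne'
    push_cast
    field_simp
  rw [hη.inner_compression_symm W A X hφ hφ, hμ,
    integral_congr_ae (ae_restrict_of_ae hdens), integral_const_mul, integral_complex_ofReal,
    Measure.setIntegral_toReal_rnDeriv hac, Measure.real]
  have := Complex.ofReal_ne_zero.2 Real.pi_ne_zero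
  field_simp

theorem IsSpanningUnitFamily.mem_extremePoints
    (hmem : hη.compression W 1 ∈ fuzzyQuadratures W)
    (hinj : ∀ A : K →L[ℂ] K,
      (∀ᵐ p ∂(volume : Measure ℝ), inner ℂ (η p) (A (η p)) = 0) → A = 0) :
    hη.compression W 1 ∈ Set.extremePoints ℝ (fuzzyQuadratures W) := by
  refine ⟨hmem, fun G₁ hG₁ G₂ hG₂ => ?_⟩
  rintro ⟨a, b, ha, hb, -, hab⟩
  obtain ⟨A, hA⟩ := hη.exists_eq_compression W hG₁ ha fun X ψ => by
    obtain ⟨s, hs, h⟩ := hG₂.1.exists_nonneg X ψ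
    have h1 : inner ℂ ψ (hη.compression W 1 X ψ) =
        (a : ℂ) * inner ℂ ψ (G₁ X ψ) + (b : ℂ) * inner ℂ ψ (G₂ X ψ) := by
      rw [← hab, ← inner_smul_right, ← inner_smul_right, ← inner_add_right]
      rfl
    rw [h1, h, Complex.add_re, Complex.re_ofReal_mul, Complex.re_ofReal_mul, Complex.ofReal_re]
    have := mul_nonneg hb.le hs
    linarith
  have h2 : A + (-1 : ℂ) • (1 : K →L[ℂ] K) = 0 := by
    refine hinj _ (hη.ae_inner_eq_zero_of_compression_univ W ?_)
    rw [hη.compression_add, hη.compression_smul, ← hA, hG₁.1.univ, hmem.1.univ]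
    module
  have h3 : A = 1 := by
    rwa [neg_one_smul, ← sub_eq_add_neg, sub_eq_zero] at h2
  rw [hA, h3]

end Dominated

end RotatedQuadrature

end

theorem theorem4
    {H : Type*} [NormedAddCommGroup H] [InnerProductSpace ℂ H] [CompleteSpace H]
    {K : Type*} [NormedAddCommGroup K] [InnerProductSpace ℂ K] [CompleteSpace K]
    (ket : HilbertBasis ℕ ℂ H) (θ : ℝ) (W : H ≃ₗᵢ[ℂ] RotatedQuadrature.L2)
    (hW : RotatedQuadrature.IsRotatedMomentumRep ket θ W)
    (F : RotatedQuadrature.BorelSet → H →L[ℂ] H)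
    (hF : F ∈ RotatedQuadrature.fuzzyQuadratures W)
    (η : ℝ → K) (hη : RotatedQuadrature.IsSpanningUnitFamily η)
    (hFη : RotatedQuadrature.IsGivenBy W F η) :
    F ∈ Set.extremePoints ℝ (RotatedQuadrature.fuzzyQuadratures W) ↔
      ∀ A : K →L[ℂ] K,
        (∀ᵐ p ∂(MeasureTheory.volume : MeasureTheory.Measure ℝ), inner ℂ (η p) (A (η p)) = 0) →
          A = 0 := by
  obtain rfl := hFη.eq_compression_one hη W
  exact ⟨fun hext A => hη.eq_zero_of_extreme W hext, hη.mem_extremePoints W hF⟩
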